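/- Let $H$ be a complex separable infinite-dimensional Hilbert space; "ideal" means two-sided ideal of $B(H)$. For $X\in B(H)$ let $s(X)=\langle s_1(X),s_2(X),\dots\rangle$ be its sequence of $s$-numbers, $s_n(X)=\inf\{\|X-F\| : \operatorname{rank}F<n\}$. Let $c_o^*$ be the set of nonnegative nonincreasing real sequences converging to $0$, and for an ideal $I$ let $\Sigma(I)=\{s(X) : X\in I\}\cap c_o^*$ be its characteristic set. For a sequence $\eta$ let $\eta_a=\langle\frac1n\sum_{i=1}^n\eta_i\rangle_{n\ge1}$ be its arithmetic mean. For an ideal $I$, the pre-arithmetic mean ideal ${}_aI$ and the arithmetic mean ideal $I_a$ are the ideals of compact operators with characteristic sets \[ \Sigma({}_aI)=\{\xi\in c_o^* : \xi_a\in\Sigma(I)\},\qquad \Sigma(I_a)=\{\xi\in c_o^* : \xi=O(\eta_a)\text{ for some }\eta\in\Sigma(I)\}, \] where $\xi=O(\eta_a)$ means that for some constant $C$, $\xi_n\le C(\eta_a)_n$ for all $n\ge 1$. The ideal $I$ is am-closed if $I={}_a(I_a)$. Put \[ I_-:=\bigcup\{J : J\subset I \text{ is an am-closed ideal}\}. \]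 Theorem. If $I$ is an ideal generated by countably many operators, then ${}_aI$ is the largest am-closed ideal contained in $I$, and $I_-={}_aI$. -/

import Mathlib

open scoped BigOperators

noncomputable section

namespace AMIdeal

/-- `c_o^*`: sequences of nonnegative reals decreasing (nonstrictly) to `0`.
The term `ξ n` is the `(n+1)`-st entry of the sequence. -/
def c0star : Set (ℕ → ℝ) :=
  {ξ | (∀ n, 0 ≤ ξ n) ∧ Antitone ξ ∧ Filter.Tendsto ξ Filter.atTop (nhds 0)}

/-- The arithmetic (Cesaro) mean `ξ_a` of a sequence. -/
def mean (ξ : ℕ → ℝ) : ℕ → ℝ :=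
  fun n => (∑ i ∈ Finset.range (n + 1), ξ i) / ((n : ℝ) + 1)

section

variable {H : Type*} [NormedAddCommGroup H] [InnerProductSpace ℂ H]

/-- The sequence of `s`-numbers of a bounded operator: the `(n+1)`-st one is the distance in
operator norm from `X` to the operators of rank at most `n`. -/
def sNum (X : H →L[ℂ] H) (n : ℕ) : ℝ :=
  sInf {r : ℝ | ∃ F : H →L[ℂ] H, LinearMap.rank (F : H →ₗ[ℂ] H) ≤ (n : Cardinal) ∧ r = ‖X - F‖}

/-- The characteristic set `Σ(I)` of a two-sided ideal `I` of `B(H)`: the `s`-number sequences of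
the compact members of `I`. -/
def charSet (I : TwoSidedIdeal (H →L[ℂ] H)) : Set (ℕ → ℝ) :=
  {ξ | ξ ∈ c0star ∧ ∃ X ∈ I, sNum X = ξ}

/-- The inverse Calkin map: the two-sided ideal of `B(H)` generated by the operators whose
`s`-number sequence lies in `S`. If `S` is a characteristic set, it is the unique ideal of compact
operators whose characteristic set is `S`. -/
def idealOf (H : Type*) [NormedAddCommGroup H] [InnerProductSpace ℂ H] (S : Set (ℕ → ℝ)) :
    TwoSidedIdeal (H →L[ℂ] H) :=
  TwoSidedIdeal.span {X : H →L[ℂ] H | sNum X ∈ S}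

/-- The pre-arithmetic mean ideal `_aI`. -/
def preArithMean (I : TwoSidedIdeal (H →L[ℂ] H)) : TwoSidedIdeal (H →L[ℂ] H) :=
  idealOf H {ξ | ξ ∈ c0star ∧ mean ξ ∈ charSet I}

/-- The arithmetic mean ideal `I_a`. The bound `ξ = O(η_a)` is required for all indices. -/
def arithMean (I : TwoSidedIdeal (H →L[ℂ] H)) : TwoSidedIdeal (H →L[ℂ] H) :=
  idealOf H {ξ | ξ ∈ c0star ∧ ∃ η ∈ charSet I, ∃ C : ℝ, ∀ n, ξ n ≤ C * mean η n}

/-- The arithmetic mean closure `I^- = _a(I_a)`. -/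
def amClosure (I : TwoSidedIdeal (H →L[ℂ] H)) : TwoSidedIdeal (H →L[ℂ] H) :=
  preArithMean (arithMean I)

/-- `I` is am-closed if it coincides with its am-closure. -/
def IsAmClosed (I : TwoSidedIdeal (H →L[ℂ] H)) : Prop :=
  I = amClosure I

/-- `I_-`: the union of all am-closed ideals contained in `I`. -/
def amLower (I : TwoSidedIdeal (H →L[ℂ] H)) : Set (H →L[ℂ] H) :=
  ⋃ J ∈ {J : TwoSidedIdeal (H →L[ℂ] H) | J ≤ I ∧ IsAmClosed J}, (J : Set (H →L[ℂ] H))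

/-- `I` is generated, as a two-sided ideal of `B(H)`, by countably many operators. -/
def IsCountablyGenerated (I : TwoSidedIdeal (H →L[ℂ] H)) : Prop :=
  ∃ S : Set (H →L[ℂ] H), S.Countable ∧ I = TwoSidedIdeal.span S

end

end AMIdeal

end

open scoped BigOperators

noncomputable section

namespace AMIdeal

open Filter Topology

variable {H : Type*} [NormedAddCommGroup H] [InnerProductSpace ℂ H]

/-! Relative to a fixed orthonormal basis everything reduces to sequences: an operator whose
s-numbers tend to 0 lies in an ideal exactly when the diagonal operator carrying these s-numbers
does (`diagMem_sNum`, `mem_of_diagMem_sNum`). The nonnegative diagonals of an ideal are stable under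
sums, domination and repetition of entries.

Since ξ ≤ ξ_a for nonincreasing ξ, _aI lies in I. The s-numbers of members of _aI have means that
are diagonals of I, so (_aI)_a lies in I, and this makes _aI am-closed. Countable generation plays
no role so far.

It enters in the maximality: I then has countably many diagonals σ_k such that the s-numbers of
every member of I lie below some σ_k (`exists_countable_majorants`). Let J ⊆ I be am-closed and let
ξ be the s-number sequence of a generator of J = _a(J_a), so that ξ_a ∈ Σ(J_a). If ξ_a ∉ Σ(I), no
multiple of any σ_k dominates ξ_a, and a sum of rectangles (`exists_mean_le_not_le`) gives μ with
μ_a ≤ 2ξ_a that lies below no σ_k. But then μ_a ∈ Σ(J_a), hence μ is a diagonal of J ⊆ I and does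
lie below some σ_k, a contradiction. -/

/-! ### Hilbert bases and operators prescribed on them -/

/-- An infinite-dimensional separable Hilbert space has a Hilbert basis indexed by `ℕ`. -/
theorem exists_hilbertBasis_nat [CompleteSpace H] [TopologicalSpace.SeparableSpace H]
    (hH : ¬ FiniteDimensional ℂ H) : Nonempty (HilbertBasis ℕ ℂ H) := by
  obtain ⟨w, b, hb⟩ := exists_hilbertBasis ℂ H
  have hon : Orthonormal ℂ ((↑) : w → H) := hb ▸ b.orthonormal
  have hcount : w.Countable := by
    suffices hdisj : w.PairwiseDisjoint fun x : H => Metric.ball x (1 / 2) by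
      exact hdisj.countable_of_isOpen (fun _ _ => Metric.isOpen_ball)
        (fun x _ => ⟨x, Metric.mem_ball_self (by norm_num)⟩)
    intro x hx y hy hxy
    refine Metric.ball_disjoint_ball ?_
    have h0 : inner ℂ x y = 0 := hon.2 (i := ⟨x, hx⟩) (j := ⟨y, hy⟩) (by simpa using hxy)
    have hx1 : ‖x‖ = 1 := hon.1 ⟨x, hx⟩
    have hy1 : ‖y‖ = 1 := hon.1 ⟨y, hy⟩
    have h2 : ‖x - y‖ ^ 2 = 2 := by
      rw [@norm_sub_sq ℂ, h0, hx1, hy1]; norm_num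
    rw [dist_eq_norm]
    nlinarith [norm_nonneg (x - y)]
  have hinf : w.Infinite := by
    intro hfin
    have := hfin.fintype
    apply hH
    exact Module.Basis.finiteDimensional_of_finite (b.toOrthonormalBasis.toBasis)
  have : Countable w := hcount
  have : Infinite w := hinf.to_subtype
  obtain ⟨e⟩ := nonempty_equiv_of_countable (α := ℕ) (β := w)
  have hon' : Orthonormal ℂ (b ∘ e) := b.orthonormal.comp _ e.injective
  refine ⟨HilbertBasis.mk hon' ?_⟩
  rw [Set.range_comp, e.surjective.range_eq, Set.image_univ, b.dense_span]

theorem ext_hilbertBasis {ι : Type*} (e : HilbertBasis ι ℂ H) {F : Type*} [NormedAddCommGroup F]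
    [NormedSpace ℂ F] {A B : H →L[ℂ] F}
    (h : ∀ i, A (e i) = B (e i)) : A = B := by
  refine ContinuousLinearMap.ext_on (s := Set.range e) ?_ ?_
  · exact Submodule.dense_iff_topologicalClosure_eq_top.2 e.dense_span
  · rintro _ ⟨i, rfl⟩
    exact h i

theorem orthogonalFamily_span_singleton {ι : Type*} {a : ι → H}
    (ha : Pairwise fun i j => inner ℂ (a i) (a j) = 0) :
    OrthogonalFamily ℂ (fun i => (Submodule.span ℂ {a i} : Submodule ℂ H))
      (fun i => (Submodule.span ℂ {a i}).subtypeₗᵢ) := by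
  rintro i j hij ⟨v, hv⟩ ⟨w, hw⟩
  obtain ⟨c, rfl⟩ := Submodule.mem_span_singleton.1 hv
  obtain ⟨d, rfl⟩ := Submodule.mem_span_singleton.1 hw
  simp [inner_smul_left, inner_smul_right, ha hij]

theorem norm_sq_sum_smul_of_orthogonal {ι : Type*} {a : ι → H}
    (ha : Pairwise fun i j => inner ℂ (a i) (a j) = 0) (c : ι → ℂ) (s : Finset ι) :
    ‖∑ i ∈ s, c i • a i‖ ^ 2 = ∑ i ∈ s, ‖c i‖ ^ 2 * ‖a i‖ ^ 2 := by
  have h := (orthogonalFamily_span_singleton ha).norm_sum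
    (fun n => ⟨c n • a n, Submodule.smul_mem _ _ (Submodule.mem_span_singleton_self _)⟩) s
  simpa [norm_smul, mul_pow] using h

theorem hasSum_norm_sq_inner {ι : Type*} (e : HilbertBasis ι ℂ H) (v : H) :
    HasSum (fun i => ‖inner ℂ (e i) v‖ ^ 2) (‖v‖ ^ 2) := by
  have h := (e.hasSum_inner_mul_inner v v).mapL Complex.reCLM
  have h2 : Complex.reCLM (inner ℂ v v) = ‖v‖ ^ 2 := (@norm_sq_eq_re_inner ℂ H _ _ _ v).symm
  rw [h2] at h
  convert! h using 1
  ext i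
  rw [← inner_conj_symm v (e i), Complex.conj_mul']
  simp [← Complex.ofReal_pow]

/-- A bounded pairwise orthogonal sequence is the image of an orthonormal basis under a bounded
operator. -/
theorem exists_clm_of_orthogonal [CompleteSpace H] (e : HilbertBasis ℕ ℂ H) {a : ℕ → H} {C : ℝ}
    (ha : Pairwise fun i j => inner ℂ (a i) (a j) = 0) (hC : ∀ n, ‖a n‖ ≤ C) :
    ∃ A : H →L[ℂ] H, ∀ n, A (e n) = a n := by
  have hsum : ∀ v, Summable fun n => inner ℂ (e n) v • a n := by
    intro v
    refine ((orthogonalFamily_span_singleton ha).summable_iff_norm_sq_summable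
      (fun n => ⟨inner ℂ (e n) v • a n,
        Submodule.smul_mem _ _ (Submodule.mem_span_singleton_self _)⟩)).2 ?_
    refine Summable.of_nonneg_of_le (fun _ => sq_nonneg _) (fun n => ?_)
      ((hasSum_norm_sq_inner e v).summable.mul_right (C ^ 2))
    simp only [Submodule.coe_norm, norm_smul, mul_pow]
    gcongr
    exact hC n
  let g : ℕ → H →L[ℂ] H := fun N => ∑ n ∈ Finset.range N, (innerSL ℂ (e n)).smulRight (a n)
  have hg : Tendsto (fun N v => g N v) atTop (𝓝 fun v => ∑' n, inner ℂ (e n) v • a n) := by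
    rw [tendsto_pi_nhds]
    intro v
    simpa [g] using (hsum v).hasSum.tendsto_sum_nat
  refine ⟨continuousLinearMapOfTendsto g hg, fun n => ?_⟩
  change ∑' m, inner ℂ (e m) (e n) • a m = a n
  rw [tsum_eq_single n]
  · simp [e.orthonormal.1 n]
  · intro m hm
    rw [e.orthonormal.2 hm, zero_smul]

/-! ### Calculus of s-numbers -/

theorem sNum_le (X F : H →L[ℂ] H) {n : ℕ}
    (hF : LinearMap.rank (F : H →ₗ[ℂ] H) ≤ (n : Cardinal)) : sNum X n ≤ ‖X - F‖ :=
  csInf_le ⟨0, by rintro _ ⟨F, _, rfl⟩; exact norm_nonneg _⟩ ⟨F, hF, rfl⟩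

theorem le_sNum {X : H →L[ℂ] H} {n : ℕ} {c : ℝ}
    (h : ∀ F : H →L[ℂ] H, LinearMap.rank (F : H →ₗ[ℂ] H) ≤ (n : Cardinal) → c ≤ ‖X - F‖) :
    c ≤ sNum X n := by
  refine le_csInf ⟨‖X - 0‖, 0, ?_, rfl⟩ ?_
  · simp
  · rintro _ ⟨F, hF, rfl⟩
    exact h F hF

theorem exists_norm_sub_lt {X : H →L[ℂ] H} {n : ℕ} {r : ℝ} (h : sNum X n < r) :
    ∃ F : H →L[ℂ] H, LinearMap.rank (F : H →ₗ[ℂ] H) ≤ (n : Cardinal) ∧ ‖X - F‖ < r := by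
  by_contra! hcon
  exact absurd (le_sNum hcon) (not_le.2 h)

theorem sNum_nonneg (X : H →L[ℂ] H) (n : ℕ) : 0 ≤ sNum X n :=
  le_sNum fun _ _ => norm_nonneg _

theorem sNum_antitone (X : H →L[ℂ] H) : Antitone (sNum X) := fun _ _ h =>
  le_sNum fun F hF => sNum_le X F (hF.trans (by exact_mod_cast h))

theorem sNum_le_norm (X : H →L[ℂ] H) (n : ℕ) : sNum X n ≤ ‖X‖ := by
  simpa using sNum_le X 0 (n := n) (by simp)

@[simp] theorem sNum_zero (n : ℕ) : sNum (0 : H →L[ℂ] H) n = 0 :=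
  le_antisymm (by simpa using sNum_le_norm (0 : H →L[ℂ] H) n) (sNum_nonneg _ _)

theorem sNum_add_le (X Y : H →L[ℂ] H) (n m : ℕ) :
    sNum (X + Y) (n + m) ≤ sNum X n + sNum Y m := by
  refine le_of_forall_pos_le_add fun ε hε => ?_
  obtain ⟨F, hF, hF'⟩ := exists_norm_sub_lt (lt_add_of_pos_right (sNum X n) (half_pos hε))
  obtain ⟨G, hG, hG'⟩ := exists_norm_sub_lt (lt_add_of_pos_right (sNum Y m) (half_pos hε))
  have h := sNum_le (X + Y) (F + G) (n := n + m) (by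
    refine (LinearMap.rank_add_le (F : H →ₗ[ℂ] H) (G : H →ₗ[ℂ] H)).trans ?_
    push_cast
    exact add_le_add hF hG)
  have h2 : ‖X + Y - (F + G)‖ ≤ ‖X - F‖ + ‖Y - G‖ := by
    rw [add_sub_add_comm]; exact norm_add_le _ _
  linarith

theorem sNum_mul_left_le (A X : H →L[ℂ] H) (n : ℕ) : sNum (A * X) n ≤ ‖A‖ * sNum X n := by
  refine le_of_forall_pos_le_add fun ε hε => ?_
  have hA : 0 < ‖A‖ + 1 := by positivity
  obtain ⟨F, hF, hF'⟩ := exists_norm_sub_lt (lt_add_of_pos_right (sNum X n) (div_pos hε hA))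
  have h := sNum_le (A * X) (A * F) (n := n)
    ((LinearMap.rank_comp_le_right (F : H →ₗ[ℂ] H) (A : H →ₗ[ℂ] H)).trans hF)
  have h2 : ‖A * X - A * F‖ ≤ ‖A‖ * ‖X - F‖ := by
    rw [← mul_sub]; exact norm_mul_le _ _
  have h3 : ‖A‖ * (ε / (‖A‖ + 1)) ≤ ε := by
    rw [mul_div_assoc', div_le_iff₀ hA]; nlinarith
  nlinarith [norm_nonneg A, mul_le_mul_of_nonneg_left hF'.le (norm_nonneg A)]

theorem sNum_mul_right_le (X B : H →L[ℂ] H) (n : ℕ) : sNum (X * B) n ≤ ‖B‖ * sNum X n := by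
  refine le_of_forall_pos_le_add fun ε hε => ?_
  have hA : 0 < ‖B‖ + 1 := by positivity
  obtain ⟨F, hF, hF'⟩ := exists_norm_sub_lt (lt_add_of_pos_right (sNum X n) (div_pos hε hA))
  have h := sNum_le (X * B) (F * B) (n := n)
    ((LinearMap.rank_comp_le_left (B : H →ₗ[ℂ] H) (F : H →ₗ[ℂ] H)).trans hF)
  have h2 : ‖X * B - F * B‖ ≤ ‖X - F‖ * ‖B‖ := by
    rw [← sub_mul]; exact norm_mul_le _ _
  have h3 : ‖B‖ * (ε / (‖B‖ + 1)) ≤ ε := by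
    rw [mul_div_assoc', div_le_iff₀ hA]; nlinarith
  nlinarith [norm_nonneg B, mul_le_mul_of_nonneg_left hF'.le (norm_nonneg B)]

theorem sNum_neg_le (X : H →L[ℂ] H) (n : ℕ) : sNum (-X) n ≤ sNum X n := by
  refine le_sNum fun F hF => ?_
  have h := sNum_le (-X) (-F) (n := n) (by
    have : ((-F : H →L[ℂ] H) : H →ₗ[ℂ] H) = -(F : H →ₗ[ℂ] H) := rfl
    rw [this, LinearMap.rank, LinearMap.range_neg]
    exact hF)
  rwa [← neg_sub', norm_neg] at h

/-- Dimension count: an operator of rank at most `n` kills some nonzero vector of the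
(n+1)-dimensional span of `f`, and by orthogonality of the images `X` stretches that vector by at
least `c`. -/
theorem le_sNum_of_orthonormal {X : H →L[ℂ] H} {n : ℕ} {c : ℝ} (hc : 0 ≤ c)
    {f : Fin (n + 1) → H} (hf : Orthonormal ℂ f)
    (hX : Pairwise fun i j => inner ℂ (X (f i)) (X (f j)) = 0) (hXc : ∀ i, c ≤ ‖X (f i)‖) :
    c ≤ sNum X n := by
  refine le_sNum fun F hF => ?_
  let T : (Fin (n + 1) → ℂ) →ₗ[ℂ] H := Fintype.linearCombination ℂ f
  have hrank : LinearMap.rank ((F : H →ₗ[ℂ] H) ∘ₗ T) ≤ (n : Cardinal) :=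
    (LinearMap.rank_comp_le_left T (F : H →ₗ[ℂ] H)).trans hF
  have hfin : Module.finrank ℂ (LinearMap.range ((F : H →ₗ[ℂ] H) ∘ₗ T)) ≤ n :=
    Module.finrank_le_of_rank_le hrank
  have hdim := LinearMap.finrank_range_add_finrank_ker ((F : H →ₗ[ℂ] H) ∘ₗ T)
  rw [Module.finrank_fin_fun] at hdim
  have hker : LinearMap.ker ((F : H →ₗ[ℂ] H) ∘ₗ T) ≠ ⊥ := by
    intro h
    rw [h, finrank_bot] at hdim
    omega
  obtain ⟨v, hv, hv0⟩ := Submodule.exists_mem_ne_zero_of_ne_bot hker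
  have hFv : F (T v) = 0 := by simpa using hv
  have hT : T v = ∑ i, v i • f i := by simp [T, Fintype.linearCombination_apply]
  have h1 : ‖T v‖ ^ 2 = ∑ i, ‖v i‖ ^ 2 := by
    rw [hT, norm_sq_sum_smul_of_orthogonal hf.2]
    simp [hf.1]
  have h2 : ‖X (T v)‖ ^ 2 = ∑ i, ‖v i‖ ^ 2 * ‖X (f i)‖ ^ 2 := by
    rw [hT, map_sum]
    simp_rw [map_smul]
    exact norm_sq_sum_smul_of_orthogonal hX v _
  have h3 : (c * ‖T v‖) ^ 2 ≤ ‖X (T v)‖ ^ 2 := by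
    rw [mul_pow, h1, h2, Finset.mul_sum]
    refine Finset.sum_le_sum fun i _ => ?_
    rw [mul_comm]
    gcongr
    exact hXc i
  have h4 : c * ‖T v‖ ≤ ‖X (T v)‖ := le_of_sq_le_sq h3 (norm_nonneg _)
  have hpos : 0 < ‖T v‖ := by
    obtain ⟨i, hi⟩ := Function.ne_iff.1 hv0
    have : 0 < ∑ i, ‖v i‖ ^ 2 :=
      Finset.sum_pos' (fun _ _ => sq_nonneg _) ⟨i, Finset.mem_univ _, by
        have : 0 < ‖v i‖ := norm_pos_iff.2 hi
        positivity⟩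
    rw [← h1] at this
    exact (norm_nonneg _).lt_of_ne fun h => by simp [← h] at this
  have h5 : ‖X (T v)‖ ≤ ‖X - F‖ * ‖T v‖ := by
    have := (X - F).le_opNorm (T v)
    rwa [sub_apply, hFv, sub_zero] at this
  exact le_of_mul_le_mul_right (h4.trans h5) hpos

/-- An operator which is diagonal with respect to a Hilbert basis acts coordinatewise. -/
theorem inner_diagonal_apply {ι : Type*} (e : HilbertBasis ι ℂ H) {D : H →L[ℂ] H} {c : ι → ℂ}
    (hD : ∀ i, D (e i) = c i • e i) (i : ι) (v : H) :
    inner ℂ (e i) (D v) = c i * inner ℂ (e i) v := by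
  have h : (innerSL ℂ (e i)).comp D = c i • innerSL ℂ (e i) := by
    refine ext_hilbertBasis e fun j => ?_
    by_cases hij : i = j
    · subst hij
      simp [hD]
    · simp [hD, e.orthonormal.2 hij]
  simpa using congrArg (fun T : H →L[ℂ] ℂ => T v) h

theorem norm_diagonal_le {ι : Type*} (e : HilbertBasis ι ℂ H) {D : H →L[ℂ] H} {c : ι → ℂ}
    (hD : ∀ i, D (e i) = c i • e i) {C : ℝ} (hC0 : 0 ≤ C) (hC : ∀ i, ‖c i‖ ≤ C) : ‖D‖ ≤ C := by
  refine D.opNorm_le_bound hC0 fun v => ?_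
  refine le_of_sq_le_sq ?_ (by positivity)
  rw [mul_pow]
  refine hasSum_le (fun i => ?_) (hasSum_norm_sq_inner e (D v))
    ((hasSum_norm_sq_inner e v).mul_left (C ^ 2))
  rw [inner_diagonal_apply e hD, norm_mul, mul_pow]
  gcongr
  exact hC i

theorem sNum_diagonal (e : HilbertBasis ℕ ℂ H) {D : H →L[ℂ] H} {ξ : ℕ → ℝ} (h0 : ∀ n, 0 ≤ ξ n)
    (hanti : Antitone ξ) (hD : ∀ n, D (e n) = (ξ n : ℂ) • e n) : sNum D = ξ := by
  ext n
  apply le_antisymm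
  · let F : H →L[ℂ] H := ∑ i ∈ Finset.range n, (innerSL ℂ (e i)).smulRight ((ξ i : ℂ) • e i)
    have hF : LinearMap.rank (F : H →ₗ[ℂ] H) ≤ (n : Cardinal) := by
      classical
      have hle : LinearMap.range (F : H →ₗ[ℂ] H) ≤
          Submodule.span ℂ ((Finset.range n).image e : Set H) := by
        rintro _ ⟨v, rfl⟩
        simp only [F, ContinuousLinearMap.coe_coe, sum_apply,
          ContinuousLinearMap.smulRight_apply]
        refine Submodule.sum_mem _ fun i hi => Submodule.smul_mem _ _ (Submodule.smul_mem _ _ ?_)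
        exact Submodule.subset_span (by simpa using ⟨i, by simpa using hi, rfl⟩)
      refine (Submodule.rank_mono hle).trans ?_
      refine (rank_span_finset_le _).trans ?_
      exact_mod_cast Finset.card_image_le.trans (Finset.card_range n).le
    refine (sNum_le D F hF).trans ?_
    refine norm_diagonal_le e (c := fun i => if i < n then 0 else (ξ i : ℂ)) (fun i => ?_) (h0 n)
      (fun i => ?_)
    · have hFi : F (e i) = if i < n then (ξ i : ℂ) • e i else 0 := by
        simp only [F, sum_apply, ContinuousLinearMap.smulRight_apply,
          innerSL_apply_apply, orthonormal_iff_ite.1 e.orthonormal]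
        simp
      rw [sub_apply, hFi, hD]
      split_ifs <;> simp
    · split_ifs with h
      · simpa using h0 n
      · simpa [abs_of_nonneg (h0 i)] using hanti (not_lt.1 h)
  · refine le_sNum_of_orthonormal (f := fun i : Fin (n + 1) => e i) (h0 n)
      (e.orthonormal.comp _ Fin.val_injective) (fun i j hij => ?_) (fun i => ?_)
    · have : inner ℂ (e i) (e j) = 0 := e.orthonormal.2 (fun h => hij (Fin.ext h))
      simp [hD, this]
    · rw [hD, norm_smul, e.orthonormal.1, mul_one, Complex.norm_real, Real.norm_of_nonneg (h0 _)]
      exact hanti (Nat.lt_succ_iff.1 i.2)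

/-! ### Greedy orthonormal sequences realising s-numbers -/

/-- Recursion in which each term may depend on all earlier ones; it drives both greedy constructions
below. -/
theorem exists_seq_of_forall_list {α : Type*} {P : List α → α → Prop} (h : ∀ l, ∃ y, P l y) :
    ∃ f : ℕ → α, ∀ n, P ((List.range n).map f) (f n) := by
  choose c hc using h
  let g : ℕ → List α := fun n => Nat.rec [] (fun _ l => l ++ [c l]) n
  have hg : ∀ n, g n = (List.range n).map fun n => c (g n) := by
    intro n
    induction n with
    | zero => rfl
    | succ n ih =>
      rw [List.range_succ, List.map_append, ← ih]
      rfl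
  exact ⟨fun n => c (g n), fun n => hg n ▸ hc (g n)⟩

theorem exists_norm_eq_one_mem_orthogonal (hH : ¬ FiniteDimensional ℂ H) (K : Submodule ℂ H)
    [FiniteDimensional ℂ K] : ∃ f ∈ Kᗮ, ‖f‖ = 1 := by
  have hK : Kᗮ ≠ ⊥ := by
    intro h
    rw [Submodule.orthogonal_eq_bot_iff] at h
    subst h
    exact hH (Module.Finite.equiv (Submodule.topEquiv (R := ℂ) (M := H)))
  obtain ⟨v, hv, hv0⟩ := Submodule.exists_mem_ne_zero_of_ne_bot hK
  refine ⟨((‖v‖⁻¹ : ℝ) : ℂ) • v, Submodule.smul_mem _ _ hv, ?_⟩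
  rw [norm_smul, Complex.norm_real, norm_inv, norm_norm, inv_mul_cancel₀ (norm_ne_zero_iff.2 hv0)]

/-- A homogeneous estimate may be checked on unit vectors. -/
theorem norm_apply_le_of_unit {K : Submodule ℂ H} {X : H →L[ℂ] H} {c : ℝ}
    (h : ∀ f ∈ K, ‖f‖ = 1 → ‖X f‖ ≤ c) {g : H} (hg : g ∈ K) : ‖X g‖ ≤ c * ‖g‖ := by
  rcases eq_or_ne g 0 with rfl | hg0
  · simp
  have hpos := norm_pos_iff.2 hg0
  have := h (((‖g‖⁻¹ : ℝ) : ℂ) • g) (Submodule.smul_mem _ _ hg) (by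
    rw [norm_smul, Complex.norm_real, norm_inv, norm_norm, inv_mul_cancel₀ hpos.ne'])
  rw [map_smul, norm_smul, Complex.norm_real, norm_inv, norm_norm] at this
  rwa [inv_mul_le_iff₀ hpos, mul_comm] at this

theorem sNum_le_of_orthogonal {X : H →L[ℂ] H} {K : Submodule ℂ H} [FiniteDimensional ℂ K] {m : ℕ}
    (hK : Module.finrank ℂ K ≤ m) {c : ℝ} (hc : 0 ≤ c) (h : ∀ g ∈ Kᗮ, ‖X g‖ ≤ c * ‖g‖) :
    sNum X m ≤ c := by
  refine (sNum_le X (X * K.starProjection) ?_).trans ?_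
  · refine (LinearMap.rank_comp_le_right (K.starProjection : H →ₗ[ℂ] H) (X : H →ₗ[ℂ] H)).trans ?_
    have hr : LinearMap.range (K.starProjection : H →ₗ[ℂ] H) = K := K.range_starProjection
    rw [LinearMap.rank, hr, ← Module.finrank_eq_rank]
    exact_mod_cast hK
  · refine ContinuousLinearMap.opNorm_le_bound _ hc fun v => ?_
    have h1 : (X - X * K.starProjection) v = X (Kᗮ.starProjection v) := by
      rw [Submodule.starProjection_orthogonal]
      simp
    rw [h1]
    refine (h _ (Submodule.starProjection_apply_mem _ _)).trans ?_
    gcongr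
    exact Submodule.norm_starProjection_apply_le _ _

/-- Without compactness the supremum of ‖X f‖ over unit vectors need not be attained; the factor 1/2
leaves the room needed when the s-number is positive. -/
theorem exists_unit_half_sNum_le (hH : ¬ FiniteDimensional ℂ H) (X : H →L[ℂ] H)
    (K : Submodule ℂ H) [FiniteDimensional ℂ K] {m : ℕ} (hK : Module.finrank ℂ K ≤ m) :
    ∃ f ∈ Kᗮ, ‖f‖ = 1 ∧ sNum X m / 2 ≤ ‖X f‖ := by
  rcases (sNum_nonneg X m).eq_or_lt with h0 | hpos
  · obtain ⟨f, hf, hf1⟩ := exists_norm_eq_one_mem_orthogonal hH K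
    exact ⟨f, hf, hf1, by rw [← h0]; simp⟩
  · by_contra! hcon
    have := sNum_le_of_orthogonal hK (half_pos hpos).le
      (fun g hg => norm_apply_le_of_unit (fun f hf hf1 => (hcon f hf hf1).le) hg)
    linarith

/-- The singular values of an arbitrary bounded operator are attained, up to a factor and a
dilation of the index, along an orthonormal sequence with orthogonal images. -/
theorem exists_orthonormal_half_sNum_le [CompleteSpace H] (hH : ¬ FiniteDimensional ℂ H)
    (X : H →L[ℂ] H) :
    ∃ f : ℕ → H, Orthonormal ℂ f ∧ (Pairwise fun i j => inner ℂ (X (f i)) (X (f j)) = 0) ∧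
      ∀ n, sNum X (2 * n) / 2 ≤ ‖X (f n)‖ := by
  classical
  let T : H →L[ℂ] H := ContinuousLinearMap.adjoint X * X
  have key : ∀ l : List H, ∃ y : H, (∀ x ∈ l, inner ℂ x y = 0 ∧ inner ℂ (T x) y = 0) ∧ ‖y‖ = 1 ∧
      sNum X (2 * l.length) / 2 ≤ ‖X y‖ := by
    intro l
    -- Orthogonality to `T x` makes the images orthogonal. Each earlier vector thus imposes two
    -- conditions, whence the index 2n.
    let s : Finset H := (l ++ l.map T).toFinset
    have hs : s.card ≤ 2 * l.length := by
      refine (List.toFinset_card_le _).trans ?_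
      simp; omega
    obtain ⟨y, hy, hy1, hy2⟩ := exists_unit_half_sNum_le hH X (Submodule.span ℂ (s : Set H))
      (m := 2 * l.length) ((finrank_span_finset_le_card s).trans hs)
    rw [Submodule.mem_orthogonal] at hy
    refine ⟨y, fun x hx => ⟨hy _ (Submodule.subset_span ?_), hy _ (Submodule.subset_span ?_)⟩,
      hy1, hy2⟩
    · simp [s, hx]
    · simp only [s, List.coe_toFinset, Set.mem_ofPred_eq, List.mem_append, List.mem_map]
      exact Or.inr ⟨x, hx, rfl⟩
  obtain ⟨f, hf⟩ := exists_seq_of_forall_list key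
  have hlt : ∀ m n, m < n → inner ℂ (f m) (f n) = 0 ∧ inner ℂ (X (f m)) (X (f n)) = 0 := by
    intro m n hmn
    obtain ⟨h1, h2⟩ := (hf n).1 (f m) (List.mem_map.2 ⟨m, List.mem_range.2 hmn, rfl⟩)
    refine ⟨h1, ?_⟩
    rwa [← ContinuousLinearMap.adjoint_inner_left]
  refine ⟨f, ⟨fun n => (hf n).2.1, fun i j hij => ?_⟩, fun i j hij => ?_, fun n => ?_⟩
  · rcases lt_or_gt_of_ne hij with h | h
    · exact (hlt _ _ h).1
    · exact inner_eq_zero_symm.1 (hlt _ _ h).1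
  · rcases lt_or_gt_of_ne hij with h | h
    · exact (hlt _ _ h).2
    · exact inner_eq_zero_symm.1 (hlt _ _ h).2
  · simpa using (hf n).2.2

/-- A compact operator attains its norm on the orthogonal complement of a finite-dimensional
subspace. -/
theorem exists_unit_norm_maximizer [CompleteSpace H] (hH : ¬ FiniteDimensional ℂ H)
    {X : H →L[ℂ] H} (hX : IsCompactOperator X) (K : Submodule ℂ H) [FiniteDimensional ℂ K] :
    ∃ f ∈ Kᗮ, ‖f‖ = 1 ∧ ∀ g ∈ Kᗮ, ‖X g‖ ≤ ‖X f‖ * ‖g‖ := by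
  let S : Set ℝ := {r | ∃ f ∈ Kᗮ, ‖f‖ = 1 ∧ r = ‖X f‖}
  have hSne : S.Nonempty := by
    obtain ⟨f, hf, hf1⟩ := exists_norm_eq_one_mem_orthogonal hH K
    exact ⟨_, f, hf, hf1, rfl⟩
  have hSb : BddAbove S := by
    refine ⟨‖X‖, ?_⟩
    rintro _ ⟨f, _, hf1, rfl⟩
    simpa [hf1] using X.le_opNorm f
  set d := sSup S with hd
  have hle : ∀ g ∈ Kᗮ, ‖X g‖ ≤ d * ‖g‖ := fun g hg =>
    norm_apply_le_of_unit (fun f hf hf1 => le_csSup hSb ⟨f, hf, hf1, rfl⟩) hg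
  have hd0 : 0 ≤ d := by
    obtain ⟨_, f, hf, hf1, rfl⟩ := hSne
    exact (norm_nonneg _).trans (le_csSup hSb ⟨f, hf, hf1, rfl⟩)
  rcases hd0.eq_or_lt with h0 | hpos
  · obtain ⟨f, hf, hf1⟩ := exists_norm_eq_one_mem_orthogonal hH K
    refine ⟨f, hf, hf1, fun g hg => (hle g hg).trans ?_⟩
    rw [← h0, zero_mul]
    positivity
  obtain ⟨r, -, hr, hrS⟩ := exists_seq_tendsto_sSup hSne hSb
  choose g hg hg1 hgr using hrS
  have hcomp := hX.isCompact_closure_image_closedBall (𝕜₁ := ℂ) 1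
  obtain ⟨y, -, φ, hφ, hy⟩ := hcomp.tendsto_subseq (x := fun n => X (g n)) fun n =>
    subset_closure ⟨g n, by simp [hg1], rfl⟩
  have hnorm : Tendsto (fun n => ‖X (g (φ n))‖) atTop (𝓝 d) := by
    simpa [Function.comp_def, ← hgr] using hr.comp hφ.tendsto_atTop
  have hyd : ‖y‖ = d := tendsto_nhds_unique hy.norm hnorm
  -- The images converge to `y` of norm `d`, so ‖X g_n + X g_m‖ tends to 2d. This forces ‖g_n + g_m‖
  -- towards 2, and the parallelogram law then makes ‖g_n - g_m‖ small.
  have hcauchy : CauchySeq (g ∘ φ) := by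
    rw [cauchySeq_iff_tendsto_dist_atTop_0]
    have hlim : Tendsto (fun p : ℕ × ℕ => √(4 - ‖X (g (φ p.1)) + X (g (φ p.2))‖ ^ 2 / d ^ 2))
        atTop (𝓝 0) := by
      have h1 : Tendsto (fun p : ℕ × ℕ => X (g (φ p.1)) + X (g (φ p.2))) atTop (𝓝 (y + y)) := by
        rw [← prod_atTop_atTop_eq]
        exact (hy.comp tendsto_fst).add (hy.comp tendsto_snd)
      have h2 := (((h1.norm.pow 2).div_const (d ^ 2)).const_sub 4).sqrt
      convert! h2 using 2
      rw [← two_smul ℝ y, norm_smul, hyd]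
      have : (4 : ℝ) - (‖(2 : ℝ)‖ * d) ^ 2 / d ^ 2 = 0 := by
        rw [Real.norm_ofNat]; field_simp; norm_num
      rw [this, Real.sqrt_zero]
    refine squeeze_zero (fun _ => dist_nonneg) (fun p => ?_) hlim
    apply Real.le_sqrt_of_sq_le
    have h3 := parallelogram_law_with_norm ℂ (g (φ p.1)) (g (φ p.2))
    have h4 := hle _ (Submodule.add_mem _ (hg (φ p.1)) (hg (φ p.2)))
    rw [map_add] at h4
    have h5 : ‖X (g (φ p.1)) + X (g (φ p.2))‖ ^ 2 / d ^ 2 ≤ ‖g (φ p.1) + g (φ p.2)‖ ^ 2 := by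
      rw [div_le_iff₀ (by positivity), ← mul_pow, mul_comm]
      gcongr
    rw [hg1, hg1] at h3
    simp only [Function.comp, dist_eq_norm]
    nlinarith
  obtain ⟨z, hz⟩ := cauchySeq_tendsto_of_complete hcauchy
  have hXz : ‖X z‖ = d :=
    tendsto_nhds_unique ((X.continuous.tendsto z).comp hz).norm hnorm
  refine ⟨z, ?_, ?_, fun v hv => hXz.symm ▸ hle v hv⟩
  · exact K.isClosed_orthogonal.mem_of_tendsto hz (Eventually.of_forall fun n => hg _)
  · refine tendsto_nhds_unique hz.norm ?_
    simp [hg1]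

/-- First variation: moving from `f` in the direction `g` changes ‖f‖² only to second order, so a
nonzero inner product of the images would beat the maximum. -/
theorem inner_apply_eq_zero_of_maximizer {X : H →L[ℂ] H} {M : Submodule ℂ H} {f g : H}
    (hf : f ∈ M) (hf1 : ‖f‖ = 1) (hmax : ∀ g ∈ M, ‖X g‖ ≤ ‖X f‖ * ‖g‖) (hg : g ∈ M)
    (hfg : inner ℂ f g = 0) : inner ℂ (X f) (X g) = 0 := by
  set z := inner ℂ (X f) (X g) with hz
  set C := ‖X f‖ ^ 2 * ‖g‖ ^ 2 with hC
  have hC0 : 0 ≤ C := by positivity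
  -- Small enough that the second-order term, of size `s * C` relative to `s * ‖z‖ ^ 2`, cannot
  -- absorb the first-order gain `2 * (s * ‖z‖ ^ 2)`.
  set s : ℝ := 1 / (C + 1) with hs
  have hs0 : 0 < s := by positivity
  have hsC : s * C ≤ 1 := by
    rw [hs, div_mul_eq_mul_div, one_mul, div_le_one (by positivity)]; linarith
  let t : ℂ := (s : ℂ) * (starRingEnd ℂ) z
  have ht : ‖t‖ = s * ‖z‖ := by simp [t, abs_of_pos hs0]
  have h1 := hmax (f + t • g) (M.add_mem hf (M.smul_mem t hg))
  have h2 : ‖f + t • g‖ ^ 2 = 1 + (s * ‖z‖) ^ 2 * ‖g‖ ^ 2 := by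
    rw [@norm_add_sq ℂ, inner_smul_right, hfg, hf1, norm_smul, ht]
    simp [mul_pow]
  have h3 : ‖X (f + t • g)‖ ^ 2 = ‖X f‖ ^ 2 + 2 * (s * ‖z‖ ^ 2) + (s * ‖z‖) ^ 2 * ‖X g‖ ^ 2 := by
    rw [map_add, map_smul, @norm_add_sq ℂ, inner_smul_right, norm_smul, ht, ← hz]
    have : t * z = ((s * ‖z‖ ^ 2 : ℝ) : ℂ) := by
      simp only [t]
      rw [mul_assoc, Complex.conj_mul']
      push_cast
      ring
    have hre : RCLike.re (((s * ‖z‖ ^ 2 : ℝ)) : ℂ) = s * ‖z‖ ^ 2 := Complex.ofReal_re _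
    rw [this, hre]
    ring
  have h4 : ‖X (f + t • g)‖ ^ 2 ≤ ‖X f‖ ^ 2 * ‖f + t • g‖ ^ 2 := by
    rw [← mul_pow]; gcongr
  rw [h3, h2] at h4
  have h5 : 2 * (s * ‖z‖ ^ 2) ≤ s * ‖z‖ ^ 2 * (s * C) := by
    have : 0 ≤ (s * ‖z‖) ^ 2 * ‖X g‖ ^ 2 := by positivity
    rw [hC]
    nlinarith
  have h6 : s * ‖z‖ ^ 2 * (s * C) ≤ s * ‖z‖ ^ 2 := mul_le_of_le_one_right (by positivity) hsC
  have h7 : s * ‖z‖ ^ 2 ≤ 0 := by linarith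
  have h8 : ‖z‖ ^ 2 ≤ 0 := by
    by_contra! h
    have : 0 < s * ‖z‖ ^ 2 := by positivity
    linarith
  exact norm_eq_zero.1 (pow_eq_zero_iff two_ne_zero |>.1 (le_antisymm h8 (sq_nonneg _)))

theorem exists_orthonormal_maximizers [CompleteSpace H] (hH : ¬ FiniteDimensional ℂ H)
    {X : H →L[ℂ] H} (hX : IsCompactOperator X) :
    ∃ f : ℕ → H, Orthonormal ℂ f ∧ (Pairwise fun i j => inner ℂ (X (f i)) (X (f j)) = 0) ∧
      ∀ n g, (∀ i < n, inner ℂ (f i) g = 0) → ‖X g‖ ≤ ‖X (f n)‖ * ‖g‖ := by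
  classical
  have key : ∀ l : List H, ∃ y : H, y ∈ (Submodule.span ℂ (l.toFinset : Set H))ᗮ ∧ ‖y‖ = 1 ∧
      ∀ g ∈ (Submodule.span ℂ (l.toFinset : Set H))ᗮ, ‖X g‖ ≤ ‖X y‖ * ‖g‖ := fun l =>
    exists_unit_norm_maximizer hH hX _
  obtain ⟨f, hf⟩ := exists_seq_of_forall_list key
  have hmem : ∀ n g, g ∈ (Submodule.span ℂ (((List.range n).map f).toFinset : Set H))ᗮ ↔
      ∀ i < n, inner ℂ (f i) g = 0 := by
    intro n g
    rw [Submodule.mem_orthogonal]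
    constructor
    · intro h i hi
      exact h _ (Submodule.subset_span (by simpa using ⟨i, hi, rfl⟩))
    · intro h u hu
      induction hu using Submodule.span_induction with
      | mem x hx =>
        obtain ⟨i, hi, rfl⟩ : ∃ i < n, f i = x := by simpa using hx
        exact h i hi
      | zero => exact inner_zero_left _
      | add x y _ _ hx hy => rw [inner_add_left, hx, hy, add_zero]
      | smul a x _ hx => rw [inner_smul_left, hx, mul_zero]
  have hlt : ∀ m n, m < n → inner ℂ (f m) (f n) = 0 ∧ inner ℂ (X (f m)) (X (f n)) = 0 := by
    intro m n hmn
    have hn := (hmem n (f n)).1 (hf n).1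
    refine ⟨hn m hmn, inner_apply_eq_zero_of_maximizer (hf m).1 (hf m).2.1 (hf m).2.2 ?_
      (hn m hmn)⟩
    exact (hmem m (f n)).2 fun i hi => hn i (hi.trans hmn)
  refine ⟨f, ⟨fun n => (hf n).2.1, fun i j hij => ?_⟩, fun i j hij => ?_, fun n g hg => ?_⟩
  · rcases lt_or_gt_of_ne hij with h | h
    · exact (hlt _ _ h).1
    · exact inner_eq_zero_symm.1 (hlt _ _ h).1
  · rcases lt_or_gt_of_ne hij with h | h
    · exact (hlt _ _ h).2
    · exact inner_eq_zero_symm.1 (hlt _ _ h).2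
  · exact (hf n).2.2 g ((hmem n g).2 hg)

theorem isCompactOperator_of_rank_le [CompleteSpace H] {F : H →L[ℂ] H} {n : ℕ}
    (hF : LinearMap.rank (F : H →ₗ[ℂ] H) ≤ (n : Cardinal)) : IsCompactOperator F := by
  have hfd : FiniteDimensional ℂ (LinearMap.range (F : H →ₗ[ℂ] H)) :=
    Module.rank_lt_aleph0_iff.1 (hF.trans_lt Cardinal.natCast_lt_aleph0)
  have hid : IsCompactOperator (id : LinearMap.range (F : H →ₗ[ℂ] H) → _) :=
    (isCompactOperator_id_iff_finiteDimensional (𝕜 := ℂ)).2 hfd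
  exact (hid.comp_clm (F.codRestrict _ fun x => LinearMap.mem_range_self (F : H →ₗ[ℂ] H) x)).clm_comp
    (LinearMap.range (F : H →ₗ[ℂ] H)).subtypeL

theorem isCompactOperator_of_tendsto_sNum [CompleteSpace H] {X : H →L[ℂ] H}
    (hX : Tendsto (sNum X) atTop (𝓝 0)) : IsCompactOperator X := by
  have hlt : ∀ n : ℕ, sNum X n < sNum X n + 1 / ((n : ℝ) + 1) := fun n =>
    lt_add_of_pos_right _ (by positivity)
  choose F hF hF' using fun n => exists_norm_sub_lt (hlt n)
  refine isCompactOperator_of_tendsto (F := F) (l := atTop) ?_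
    (Eventually.of_forall fun n => isCompactOperator_of_rank_le (hF n))
  rw [tendsto_iff_norm_sub_tendsto_zero]
  refine squeeze_zero (fun _ => norm_nonneg _) (fun n => ?_)
    (by simpa only [add_zero] using hX.add tendsto_one_div_add_atTop_nhds_zero_nat)
  rw [norm_sub_rev]
  exact (hF' n).le

theorem adjoint_apply_eq_smul [CompleteSpace H] {ι : Type*} (e : HilbertBasis ι ℂ H)
    {W : H →L[ℂ] H} {a : ι → H} (hW : ∀ i, W (e i) = a i) {v : H} {m : ι} {c : ℂ}
    (hm : inner ℂ (a m) v = c) (hne : ∀ i, i ≠ m → inner ℂ (a i) v = 0) :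
    ContinuousLinearMap.adjoint W v = c • e m := by
  apply e.repr.injective
  ext i
  rw [e.repr_apply_apply, e.repr_apply_apply, ContinuousLinearMap.adjoint_inner_right, hW,
    inner_smul_right]
  by_cases hi : i = m
  · subst hi
    rw [hm, inner_self_eq_norm_sq_to_K, e.orthonormal.1]
    simp
  · simp [hne i hi, e.orthonormal.2 hi]

/-! ### Diagonal operators in an ideal -/

/-- The diagonal operator with entries `ξ`, relative to the Hilbert basis `e`, lies in `I`. -/
def DiagMem (I : TwoSidedIdeal (H →L[ℂ] H)) (e : HilbertBasis ℕ ℂ H) (ξ : ℕ → ℝ) : Prop :=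
  ∃ D ∈ I, ∀ n, D (e n) = (ξ n : ℂ) • e n

section

variable {I : TwoSidedIdeal (H →L[ℂ] H)} {e : HilbertBasis ℕ ℂ H} {ξ η : ℕ → ℝ}

theorem DiagMem.zero : DiagMem I e 0 := ⟨0, I.zero_mem, fun n => by simp⟩

theorem DiagMem.add (h : DiagMem I e ξ) (h' : DiagMem I e η) : DiagMem I e (ξ + η) := by
  obtain ⟨D, hD, hDe⟩ := h
  obtain ⟨D', hD', hDe'⟩ := h'
  exact ⟨D + D', I.add_mem hD hD', fun n => by simp [hDe, hDe', add_smul]⟩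

theorem DiagMem.sum {ι : Type*} {s : Finset ι} {f : ι → ℕ → ℝ}
    (h : ∀ i ∈ s, DiagMem I e (f i)) : DiagMem I e (fun n => ∑ i ∈ s, f i n) := by
  choose! D hD hDe using h
  refine ⟨∑ i ∈ s, D i, sum_mem hD, fun n => ?_⟩
  rw [sum_apply, Complex.ofReal_sum, Finset.sum_smul]
  exact Finset.sum_congr rfl fun i hi => hDe i hi n

variable [CompleteSpace H]

theorem exists_diagonal (e : HilbertBasis ℕ ℂ H) {c : ℕ → ℂ} {C : ℝ} (hc : ∀ n, ‖c n‖ ≤ C) :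
    ∃ D : H →L[ℂ] H, ∀ n, D (e n) = c n • e n :=
  exists_clm_of_orthogonal e (C := C)
    (fun i j hij => by simp [e.orthonormal.2 hij])
    (fun n => by simpa [norm_smul, e.orthonormal.1 n] using hc n)

/-- Since 0⁻¹ = 0, vanishing `a n` are sent to 0 and need no separate treatment. -/
theorem exists_clm_normalized (e : HilbertBasis ℕ ℂ H) {a : ℕ → H}
    (ha : Pairwise fun i j => inner ℂ (a i) (a j) = 0) :
    ∃ V : H →L[ℂ] H, ∀ n, V (e n) = ((‖a n‖⁻¹ : ℝ) : ℂ) • a n :=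
  exists_clm_of_orthogonal e (C := 1)
    (fun i j hij => by simp [ha hij])
    (fun n => by
      rw [norm_smul, Complex.norm_real, norm_inv, norm_norm]
      exact inv_mul_le_one)

/-- Multiply by the diagonal operator of the quotients ξ/η, which are bounded by |C|. Where η
vanishes so does ξ, in agreement with the convention x/0 = 0. -/
theorem DiagMem.mono (h : DiagMem I e η) (h0 : ∀ n, 0 ≤ ξ n) {C : ℝ}
    (hle : ∀ n, ξ n ≤ C * η n) : DiagMem I e ξ := by
  obtain ⟨D, hD, hDe⟩ := h
  obtain ⟨R, hR⟩ := exists_diagonal e (c := fun n => ((ξ n / η n : ℝ) : ℂ)) (C := |C|) fun n => by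
    rw [Complex.norm_real, Real.norm_eq_abs, abs_div]
    rcases eq_or_ne (η n) 0 with h | h
    · simp [h]
    · rw [div_le_iff₀ (abs_pos.2 h), ← abs_mul, abs_of_nonneg (h0 n)]
      exact (hle n).trans (le_abs_self _)
  refine ⟨R * D, I.mul_mem_left _ _ hD, fun n => ?_⟩
  rw [mul_apply_eq_comp, hDe, map_smul, hR, smul_smul]
  congr 1
  rcases eq_or_ne (η n) 0 with h | h
  · have : ξ n = 0 := le_antisymm (by simpa [h] using hle n) (h0 n)
    simp [h, this]
  · rw [← Complex.ofReal_mul, mul_div_cancel₀ _ h]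

/-- Ampliation: repeating every diagonal entry `m` times stays in the ideal. -/
theorem DiagMem.comp_div (h : DiagMem I e ξ) {m : ℕ} (hm : 0 < m) :
    DiagMem I e (fun n => ξ (n / m)) := by
  obtain ⟨D, hD, hDe⟩ := h
  -- `V r` spreads the basis over the residue class of r modulo m, and `W r` undoes this and kills
  -- the other classes; summing `V r * D * W r` puts a copy of `D` on each class.
  have hV : ∀ r, ∃ V : H →L[ℂ] H, ∀ n, V (e n) = e (n * m + r) := fun r =>
    exists_clm_of_orthogonal e (C := 1)
      (fun i j hij => e.orthonormal.2 fun h => hij (Nat.eq_of_mul_eq_mul_right hm (by omega)))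
      (fun n => (e.orthonormal.1 _).le)
  have hW : ∀ r, ∃ W : H →L[ℂ] H, ∀ n, W (e n) = if n % m = r then e (n / m) else 0 := fun r =>
    exists_clm_of_orthogonal e (C := 1)
      (fun i j hij => by
        beta_reduce
        split_ifs with hi hj
        · refine e.orthonormal.2 fun h => hij ?_
          rw [← Nat.div_add_mod i m, ← Nat.div_add_mod j m, h, hi, hj]
        all_goals simp)
      (fun n => by
        split_ifs
        · exact (e.orthonormal.1 _).le
        · simp)
  choose V hV using hV
  choose W hW using hW
  refine ⟨∑ r ∈ Finset.range m, V r * D * W r,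
    sum_mem fun r _ => I.mul_mem_right _ _ (I.mul_mem_left _ _ hD), fun n => ?_⟩
  rw [sum_apply, Finset.sum_eq_single (n % m)]
  · rw [mul_apply_eq_comp, mul_apply_eq_comp, hW, if_pos rfl, hDe, map_smul,
      hV, mul_comm, Nat.div_add_mod]
  · intro r _ hr
    rw [mul_apply_eq_comp, hW, if_neg hr.symm, map_zero]
  · intro h
    exact absurd (Finset.mem_range.2 (Nat.mod_lt n hm)) h

/-- Compressing `X` between an orthonormal sequence and its normalised images gives a diagonal
operator with entries at least s_{2n}/2. Repeating each entry twice repairs the index. Compactness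
is not needed. -/
theorem diagMem_sNum (hH : ¬ FiniteDimensional ℂ H) (e : HilbertBasis ℕ ℂ H) {X : H →L[ℂ] H}
    (hX : X ∈ I) : DiagMem I e (sNum X) := by
  obtain ⟨f, hf, hXf, hs⟩ := exists_orthonormal_half_sNum_le hH X
  obtain ⟨B, hB⟩ := exists_clm_of_orthogonal e (C := 1) hf.2 fun n => (hf.1 n).le
  obtain ⟨V, hV⟩ := exists_clm_normalized e hXf
  have hdiag : DiagMem I e (fun n => ‖X (f n)‖) := by
    refine ⟨ContinuousLinearMap.adjoint V * X * B, I.mul_mem_right _ _ (I.mul_mem_left _ _ hX),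
      fun n => ?_⟩
    rw [mul_apply_eq_comp, mul_apply_eq_comp, hB]
    refine adjoint_apply_eq_smul e hV ?_ fun i hi => ?_
    · rw [inner_smul_left, inner_self_eq_norm_sq_to_K, Complex.conj_ofReal]
      rcases eq_or_ne ‖X (f n)‖ 0 with h | h
      · simp [h]
      · have : (‖X (f n)‖ : ℂ) ≠ 0 := by exact_mod_cast h
        push_cast
        field_simp
        rfl
    · rw [inner_smul_left, hXf hi, mul_zero]
  have h2 : DiagMem I e (fun n => sNum X (2 * n)) :=
    hdiag.mono (fun n => sNum_nonneg X _) (C := 2) fun n => by linarith [hs n]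
  refine (h2.comp_div two_pos).mono (fun n => sNum_nonneg X n) (C := 1) fun n => ?_
  rw [one_mul]
  exact sNum_antitone X (Nat.mul_div_le n 2)

/-- Schmidt decomposition: X = V D W*, where `D` has entries ‖X f_n‖ ≤ s_n along greedily chosen
maximisers f_n. -/
theorem mem_of_diagMem_sNum (hH : ¬ FiniteDimensional ℂ H) (e : HilbertBasis ℕ ℂ H)
    {X : H →L[ℂ] H} (hX : Tendsto (sNum X) atTop (𝓝 0)) (h : DiagMem I e (sNum X)) : X ∈ I := by
  obtain ⟨f, hf, hXf, hmax⟩ :=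
    exists_orthonormal_maximizers hH (isCompactOperator_of_tendsto_sNum hX)
  have hle : ∀ n, ‖X (f n)‖ ≤ sNum X n := fun n =>
    le_sNum_of_orthonormal (f := fun i : Fin (n + 1) => f i) (norm_nonneg _)
      (hf.comp _ Fin.val_injective) (fun i j hij => hXf fun h => hij (Fin.ext h)) fun i => by
        have := hmax i (f n) fun j hj => hf.2 (by have := i.2; omega)
        rwa [hf.1, mul_one] at this
  obtain ⟨D, hD, hDe⟩ := h.mono (ξ := fun n => ‖X (f n)‖) (fun n => norm_nonneg _) (C := 1)
    (by simpa using hle)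
  obtain ⟨W, hW⟩ := exists_clm_of_orthogonal e (C := 1) hf.2 fun n => (hf.1 n).le
  obtain ⟨V, hV⟩ := exists_clm_normalized e hXf
  have hWW : ContinuousLinearMap.adjoint W * W = 1 := ext_hilbertBasis e fun n => by
    rw [mul_apply_eq_comp, hW, adjoint_apply_eq_smul e hW (c := 1) (m := n)]
    · simp
    · simp [inner_self_eq_norm_sq_to_K, hf.1 n]
    · exact fun i hi => hf.2 hi
  have hXW : X * W = V * D := ext_hilbertBasis e fun n => by
    rw [mul_apply_eq_comp, mul_apply_eq_comp, hW, hDe, map_smul, hV,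
      smul_smul, ← Complex.ofReal_mul]
    rcases eq_or_ne ‖X (f n)‖ 0 with h | h
    · simp [norm_eq_zero.1 h]
    · rw [mul_inv_cancel₀ h]; simp
  -- A vector orthogonal to every f_n satisfies ‖X g‖ ≤ s_n ‖g‖ for all n, and s_n tends to 0. Hence
  -- `X` lives on the range of `W`.
  have hker : ∀ g, (∀ n, inner ℂ (f n) g = 0) → X g = 0 := by
    intro g hg
    rw [← norm_le_zero_iff]
    refine ge_of_tendsto' (x := atTop) (f := fun n => sNum X n * ‖g‖)
      (by simpa using hX.mul_const ‖g‖) (fun n => ?_)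
    exact (hmax n g fun i _ => hg i).trans (by gcongr; exact hle n)
  have hfac : X = V * D * ContinuousLinearMap.adjoint W := by
    rw [← hXW]
    ext g
    have h0 := hker (g - W (ContinuousLinearMap.adjoint W g)) fun n => by
      rw [← hW n, ← ContinuousLinearMap.adjoint_inner_right, map_sub]
      have := congrArg (fun T : H →L[ℂ] H => T (ContinuousLinearMap.adjoint W g)) hWW
      simp only [mul_apply_eq_comp, one_apply_eq_self] at this
      rw [this, sub_self, inner_zero_right]
    rw [map_sub, sub_eq_zero] at h0
    exact h0
  rw [hfac]
  exact I.mul_mem_right _ _ (I.mul_mem_left _ _ hD)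

end

/-! ### Arithmetic means of sequences -/

section Sequences

variable {ξ η : ℕ → ℝ}

theorem le_mean (hξ : Antitone ξ) (n : ℕ) : ξ n ≤ mean ξ n := by
  rw [mean, le_div_iff₀ (by positivity)]
  have := Finset.card_nsmul_le_sum (Finset.range (n + 1)) ξ (ξ n)
    fun i hi => hξ (Nat.lt_succ_iff.1 (Finset.mem_range.1 hi))
  rw [Finset.card_range, nsmul_eq_mul] at this
  push_cast at this
  linarith

theorem mean_nonneg (hξ : ∀ n, 0 ≤ ξ n) (n : ℕ) : 0 ≤ mean ξ n :=
  div_nonneg (Finset.sum_nonneg fun i _ => hξ i) (by positivity)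

theorem mean_le_mul_mean {C : ℝ} (h : ∀ n, ξ n ≤ C * η n) (n : ℕ) : mean ξ n ≤ C * mean η n := by
  rw [mean, mean, mul_div_assoc', Finset.mul_sum]
  gcongr
  exact h _

theorem mean_mul_succ (ξ : ℕ → ℝ) (n : ℕ) :
    mean ξ n * ((n : ℝ) + 1) = ∑ i ∈ Finset.range (n + 1), ξ i :=
  div_mul_cancel₀ _ (by positivity)

theorem mean_antitone (hξ : Antitone ξ) : Antitone (mean ξ) := by
  refine antitone_nat_of_succ_le fun n => ?_
  have h1 := mean_mul_succ ξ n
  have h2 := mean_mul_succ ξ (n + 1)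
  rw [Finset.sum_range_succ, ← h1] at h2
  have h3 : ξ (n + 1) ≤ mean ξ n := (hξ n.le_succ).trans (le_mean hξ n)
  push_cast at h2
  have hpos : (0 : ℝ) < (n : ℝ) + 1 + 1 := by positivity
  refine le_of_mul_le_mul_right ?_ hpos
  linarith

theorem mean_mem_c0star (hξ : ξ ∈ c0star) : mean ξ ∈ c0star := by
  refine ⟨mean_nonneg hξ.1, mean_antitone hξ.2.1, ?_⟩
  have h := (hξ.2.2.cesaro).comp (tendsto_add_atTop_nat 1)
  refine h.congr fun n => ?_
  simp [mean, div_eq_inv_mul]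

theorem sum_range_half_le (hξ : ∀ n, 0 ≤ ξ n) (N : ℕ) :
    ∑ i ∈ Finset.range N, ξ (i / 2) ≤ 2 * ∑ i ∈ Finset.range N, ξ i := by
  have h : ∀ N, ∑ i ∈ Finset.range (2 * N), ξ (i / 2) = 2 * ∑ i ∈ Finset.range N, ξ i := by
    intro N
    induction N with
    | zero => simp
    | succ N ih =>
      rw [Nat.mul_succ, Finset.sum_range_succ, Finset.sum_range_succ, ih, Finset.sum_range_succ,
        Nat.mul_div_cancel_left _ two_pos, show (2 * N + 1) / 2 = N by omega]
      ring
  rw [← h]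
  exact Finset.sum_le_sum_of_subset_of_nonneg (Finset.range_mono (by omega)) fun i _ _ => hξ _

/-- The truncation of a mean at an index is dominated in partial sums by the sequence itself. -/
theorem sum_range_ite_mean_le (h0 : ∀ n, 0 ≤ ξ n) (hξ : Antitone ξ) (N n : ℕ) :
    ∑ i ∈ Finset.range (n + 1), (if i ≤ N then mean ξ N else 0) ≤
      ∑ i ∈ Finset.range (n + 1), ξ i := by
  rcases le_total n N with h | h
  · rw [← mean_mul_succ ξ]
    calc _ = ∑ i ∈ Finset.range (n + 1), mean ξ N :=
          Finset.sum_congr rfl fun i hi => if_pos (by have := Finset.mem_range.1 hi; omega)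
      _ = mean ξ N * ((n : ℝ) + 1) := by simp [mul_comm]
      _ ≤ _ := by gcongr; exact mean_antitone hξ h
  · calc _ = ∑ i ∈ Finset.range (N + 1), mean ξ N := by
          rw [← Finset.sum_filter]
          congr 1
          ext i
          simp only [Finset.mem_filter, Finset.mem_range]
          omega
      _ = mean ξ N * ((N : ℝ) + 1) := by simp [mul_comm]
      _ = ∑ i ∈ Finset.range (N + 1), ξ i := mean_mul_succ _ _
      _ ≤ _ := Finset.sum_le_sum_of_subset_of_nonneg (Finset.range_mono (by omega))
        fun i _ _ => h0 i

/-- If the mean of `ξ` is not dominated by any multiple of a member of a countable family `σ`, then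
some `μ` whose mean is dominated by the mean of `ξ` lies below no member of the family. -/
theorem exists_mean_le_not_le (hξ : ξ ∈ c0star) (σ : ℕ → ℕ → ℝ)
    (h : ∀ k C, ∃ n, C * σ k n < mean ξ n) :
    ∃ μ ∈ c0star, (∀ n, mean μ n ≤ 2 * mean ξ n) ∧ ∀ k, ∃ n, σ k n < μ n := by
  -- The constants 2^k offset the weights 2^{-k} in `t`: the k-th rectangle, of height 2^{-k} ξ_a(N
  -- k) on the indices up to N k, alone exceeds σ_k at N k. The weights sum to 2, which is the
  -- constant in the bound on the mean.
  choose N hN using fun k => h k (2 ^ k)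
  let t : ℕ → ℕ → ℝ := fun n k => (1 / 2) ^ k * (if n ≤ N k then mean ξ (N k) else 0)
  have hm0 := mean_nonneg hξ.1
  have ht0 : ∀ n k, 0 ≤ t n k := fun n k => by
    have := hm0 (N k)
    simp only [t]
    split_ifs <;> positivity
  have htle : ∀ n k, t n k ≤ (1 / 2) ^ k * mean ξ 0 := fun n k => by
    simp only [t]
    gcongr
    split_ifs
    · exact mean_antitone hξ.2.1 (Nat.zero_le _)
    · exact hm0 0
  have hbound : Summable fun k : ℕ => (1 / 2 : ℝ) ^ k * mean ξ 0 :=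
    summable_geometric_two.mul_right _
  have hts : ∀ n, Summable (t n) := fun n => .of_nonneg_of_le (ht0 n) (htle n) hbound
  refine ⟨fun n => ∑' k, t n k, ⟨fun n => tsum_nonneg (ht0 n), fun n m hnm => ?_, ?_⟩,
    fun n => ?_, fun k => ⟨N k, ?_⟩⟩
  · refine (hts m).tsum_le_tsum (fun k => ?_) (hts n)
    simp only [t]
    gcongr
    split_ifs with h1 h2
    · exact le_rfl
    · omega
    · exact hm0 _
    · exact le_rfl
  · rw [← tsum_zero (α := ℝ) (β := ℕ)]
    refine tendsto_tsum_of_dominated_convergence hbound (fun k => ?_)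
      (Eventually.of_forall fun n k => ?_)
    · refine tendsto_const_nhds.congr' ?_
      filter_upwards [eventually_gt_atTop (N k)] with n hn
      simp [t, not_le.2 hn]
    · rw [Real.norm_of_nonneg (ht0 n k)]
      exact htle n k
  · rw [mean, mean, mul_div_assoc']
    gcongr
    rw [← Summable.tsum_finsetSum fun i _ => hts i, ← tsum_geometric_two, ← tsum_mul_right]
    refine Summable.tsum_le_tsum (fun k => ?_) (summable_sum fun i _ => hts i)
      (summable_geometric_two.mul_right _)
    simp only [t]
    rw [← Finset.mul_sum]
    exact mul_le_mul_of_nonneg_left (sum_range_ite_mean_le hξ.1 hξ.2.1 _ _) (by positivity)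
  · refine lt_of_lt_of_le ?_ ((hts (N k)).le_tsum k fun j _ => ht0 _ j)
    simp only [t, le_refl, if_true]
    rw [one_div, inv_pow, lt_inv_mul_iff₀ (by positivity)]
    exact hN k

end Sequences

/-! ### Majorants for a countably generated ideal -/

theorem sNum_add_le_half (X Y : H →L[ℂ] H) (n : ℕ) :
    sNum (X + Y) n ≤ sNum X (n / 2) + sNum Y (n / 2) :=
  (sNum_antitone _ (by omega)).trans (sNum_add_le X Y (n / 2) (n / 2))

/-- Passing to means turns the dilation of the index in `sNum_add_le_half` into a constant factor 2.
-/
theorem mean_sNum_add_le (X Y : H →L[ℂ] H) (n : ℕ) :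
    mean (sNum (X + Y)) n ≤ 2 * (mean (sNum X) + mean (sNum Y)) n := by
  rw [Pi.add_apply, mean, mean, mean, ← add_div, mul_div_assoc']
  gcongr
  calc _ ≤ ∑ i ∈ Finset.range (n + 1), (sNum X (i / 2) + sNum Y (i / 2)) :=
        Finset.sum_le_sum fun i _ => sNum_add_le_half X Y i
    _ ≤ _ := by
        rw [Finset.sum_add_distrib, mul_add]
        exact add_le_add (sum_range_half_le (sNum_nonneg X) _) (sum_range_half_le (sNum_nonneg Y) _)

/-- The sequences which dominate the singular numbers of the members of the ideal generated by the
operators `Y j`. -/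
def majorant (Y : ℕ → H →L[ℂ] H) (m n : ℕ) : ℝ :=
  ((m : ℝ) + 1) * ∑ j ∈ Finset.range (m + 1), sNum (Y j) (n / (m + 1))

theorem majorant_nonneg (Y : ℕ → H →L[ℂ] H) (m n : ℕ) : 0 ≤ majorant Y m n :=
  mul_nonneg (by positivity) (Finset.sum_nonneg fun _ _ => sNum_nonneg _ _)

theorem mul_majorant_le (Y : ℕ → H →L[ℂ] H) {m M n n' : ℕ} {c : ℝ} (hmM : m ≤ M)
    (hc : c * ((m : ℝ) + 1) ≤ (M : ℝ) + 1) (hn : n' / (M + 1) ≤ n / (m + 1)) :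
    c * majorant Y m n ≤ majorant Y M n' := by
  rw [majorant, majorant, ← mul_assoc]
  refine mul_le_mul hc ?_ (Finset.sum_nonneg fun _ _ => sNum_nonneg _ _) (by positivity)
  calc _ ≤ ∑ j ∈ Finset.range (m + 1), sNum (Y j) (n' / (M + 1)) :=
        Finset.sum_le_sum fun j _ => sNum_antitone _ hn
    _ ≤ _ := Finset.sum_le_sum_of_subset_of_nonneg (Finset.range_mono (by omega))
        fun _ _ _ => sNum_nonneg _ _

theorem majorant_mono (Y : ℕ → H →L[ℂ] H) {m M : ℕ} (hmM : m ≤ M) (n : ℕ) :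
    majorant Y m n ≤ majorant Y M n := by
  have := mul_majorant_le Y (c := 1) (n := n) (n' := n) hmM
    (by rw [one_mul]; exact_mod_cast Nat.succ_le_succ hmM)
    (Nat.div_le_div_left (by omega) (by omega))
  rwa [one_mul] at this

theorem exists_mul_majorant_le (Y : ℕ → H →L[ℂ] H) (m : ℕ) (c : ℝ) :
    ∃ M, ∀ n, c * majorant Y m n ≤ majorant Y M n := by
  obtain ⟨k, hk⟩ := exists_nat_ge c
  -- Here M + 1 = (k + 1)(m + 1), so the prefactor of the majorant absorbs `c` ≤ k.
  refine ⟨k * (m + 1) + m, fun n => mul_majorant_le Y (by omega) ?_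
    (Nat.div_le_div_left (by nlinarith) (by omega))⟩
  push_cast
  nlinarith [(Nat.cast_nonneg m : (0 : ℝ) ≤ m)]

theorem exists_sNum_le_majorant (Y : ℕ → H →L[ℂ] H) {X : H →L[ℂ] H}
    (hX : X ∈ TwoSidedIdeal.span (Set.range Y)) : ∃ m, ∀ n, sNum X n ≤ majorant Y m n := by
  induction hX using TwoSidedIdeal.span_induction with
  | mem x hx =>
    obtain ⟨j, rfl⟩ := hx
    refine ⟨j, fun n => ?_⟩
    calc sNum (Y j) n ≤ sNum (Y j) (n / (j + 1)) := sNum_antitone _ (Nat.div_le_self _ _)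
      _ ≤ ∑ i ∈ Finset.range (j + 1), sNum (Y i) (n / (j + 1)) :=
          Finset.single_le_sum (f := fun i => sNum (Y i) (n / (j + 1)))
            (fun _ _ => sNum_nonneg _ _) (Finset.self_mem_range_succ j)
      _ ≤ _ := le_mul_of_one_le_left (Finset.sum_nonneg fun _ _ => sNum_nonneg _ _)
          (by linarith [(Nat.cast_nonneg j : (0 : ℝ) ≤ j)])
  | zero => exact ⟨0, fun n => by rw [sNum_zero]; exact majorant_nonneg _ _ _⟩
  | add x y _ _ hx hy =>
    obtain ⟨m, hm⟩ := hx
    obtain ⟨k, hk⟩ := hy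
    set M := max m k with hM
    -- Since (2M + 1) + 1 = 2(M + 1), the new index accounts both for the halving of n and for the
    -- factor 2 from adding two majorants.
    refine ⟨2 * M + 1, fun n => (sNum_add_le_half x y n).trans ?_⟩
    have h1 := (hm (n / 2)).trans (majorant_mono Y (le_max_left m k) _)
    have h2 := (hk (n / 2)).trans (majorant_mono Y (le_max_right m k) _)
    have h3 : 2 * majorant Y M (n / 2) ≤ majorant Y (2 * M + 1) n :=
      mul_majorant_le Y (by omega) (by push_cast; linarith) (by
        rw [Nat.div_div_eq_div_mul]
        exact (congrArg (n / ·) (by ring)).le)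
    linarith
  | neg x _ hx =>
    obtain ⟨m, hm⟩ := hx
    exact ⟨m, fun n => (sNum_neg_le x n).trans (hm n)⟩
  | left_absorb a x _ hx =>
    obtain ⟨m, hm⟩ := hx
    obtain ⟨M, hM⟩ := exists_mul_majorant_le Y m ‖a‖
    exact ⟨M, fun n => (sNum_mul_left_le a x n).trans
      ((mul_le_mul_of_nonneg_left (hm n) (norm_nonneg a)).trans (hM n))⟩
  | right_absorb b x _ hx =>
    obtain ⟨m, hm⟩ := hx
    obtain ⟨M, hM⟩ := exists_mul_majorant_le Y m ‖b‖
    exact ⟨M, fun n => (sNum_mul_right_le x b n).trans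
      ((mul_le_mul_of_nonneg_left (hm n) (norm_nonneg b)).trans (hM n))⟩

/-! ### Arithmetic mean ideals and maximality -/

theorem preArithMean_mono {I J : TwoSidedIdeal (H →L[ℂ] H)} (h : I ≤ J) : preArithMean I ≤ preArithMean J :=
  TwoSidedIdeal.span_mono fun _ hX =>
    ⟨hX.1, hX.2.1, hX.2.2.imp fun _ hY => ⟨h hY.1, hY.2⟩⟩

section

variable {I J : TwoSidedIdeal (H →L[ℂ] H)} [CompleteSpace H]

theorem exists_countable_majorants (hH : ¬ FiniteDimensional ℂ H) (e : HilbertBasis ℕ ℂ H)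
    (hI : IsCountablyGenerated I) :
    ∃ σ : ℕ → ℕ → ℝ, (∀ k, DiagMem I e (σ k)) ∧ ∀ X ∈ I, ∃ k, ∀ n, sNum X n ≤ σ k n := by
  obtain ⟨S, hS, rfl⟩ := hI
  -- Adjoining 0 allows an enumeration by ℕ even when `S` is empty.
  obtain ⟨Y, hY⟩ := (hS.insert 0).exists_eq_range ⟨0, Set.mem_insert _ _⟩
  have hYI : ∀ j, Y j ∈ TwoSidedIdeal.span S := by
    intro j
    have hj : Y j ∈ insert 0 S := hY ▸ Set.mem_range_self j
    rcases hj with h | h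
    · rw [h]
      exact TwoSidedIdeal.zero_mem _
    · exact TwoSidedIdeal.subset_span h
  refine ⟨majorant Y, fun k => ?_, fun X hX => exists_sNum_le_majorant Y ?_⟩
  · have h : DiagMem (TwoSidedIdeal.span S) e
        (fun n => ∑ j ∈ Finset.range (k + 1), sNum (Y j) (n / (k + 1))) :=
      DiagMem.sum fun j _ => (diagMem_sNum hH e (hYI j)).comp_div k.succ_pos
    exact h.mono (majorant_nonneg Y k) fun n => le_rfl
  · rw [← hY]
    exact TwoSidedIdeal.span_mono (Set.subset_insert _ _) hX

theorem mem_charSet_iff (hH : ¬ FiniteDimensional ℂ H) (e : HilbertBasis ℕ ℂ H) {ξ : ℕ → ℝ} :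
    ξ ∈ charSet I ↔ ξ ∈ c0star ∧ DiagMem I e ξ := by
  refine and_congr_right fun hξ => ⟨?_, ?_⟩
  · rintro ⟨X, hX, rfl⟩
    exact diagMem_sNum hH e hX
  · rintro ⟨D, hD, hDe⟩
    exact ⟨D, hD, sNum_diagonal e hξ.1 hξ.2.1 hDe⟩

theorem diagMem_idealOf (e : HilbertBasis ℕ ℂ H) {S : Set (ℕ → ℝ)} {ξ : ℕ → ℝ} (hξ : ξ ∈ c0star)
    (hS : ξ ∈ S) : DiagMem (idealOf H S) e ξ := by
  obtain ⟨D, hD⟩ := exists_diagonal e (c := fun n => (ξ n : ℂ)) (C := ξ 0) fun n => by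
    rw [Complex.norm_real, Real.norm_of_nonneg (hξ.1 n)]
    exact hξ.2.1 n.zero_le
  refine ⟨D, TwoSidedIdeal.subset_span ?_, hD⟩
  rwa [Set.mem_ofPred_eq, sNum_diagonal e hξ.1 hξ.2.1 hD]

theorem idealOf_le (hH : ¬ FiniteDimensional ℂ H) (e : HilbertBasis ℕ ℂ H) {S : Set (ℕ → ℝ)}
    (hS : ∀ ξ ∈ S, ξ ∈ c0star ∧ DiagMem I e ξ) : idealOf H S ≤ I :=
  TwoSidedIdeal.span_le.2 fun _ hX =>
    mem_of_diagMem_sNum hH e (hS _ hX).1.2.2 (hS _ hX).2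

theorem preArithMean_le (hH : ¬ FiniteDimensional ℂ H) (e : HilbertBasis ℕ ℂ H) :
    preArithMean I ≤ I :=
  idealOf_le hH e fun ξ hξ => ⟨hξ.1, ((mem_charSet_iff hH e).1 hξ.2).2.mono hξ.1.1 (C := 1)
    fun n => by rw [one_mul]; exact le_mean hξ.1.2.1 n⟩

/-- The defining property of the generators of _aI survives all ideal operations, so it holds for
every member of the span. -/
theorem diagMem_mean_sNum (hH : ¬ FiniteDimensional ℂ H) (e : HilbertBasis ℕ ℂ H)
    {X : H →L[ℂ] H} (hX : X ∈ preArithMean I) : DiagMem I e (mean (sNum X)) := by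
  induction hX using TwoSidedIdeal.span_induction with
  | mem x hx => exact ((mem_charSet_iff hH e).1 hx.2).2
  | zero =>
    refine DiagMem.zero.mono (mean_nonneg (sNum_nonneg _)) (C := 0) fun n => ?_
    simp [mean]
  | add x y _ _ hx hy =>
    exact (hx.add hy).mono (mean_nonneg (sNum_nonneg _)) (mean_sNum_add_le x y)
  | neg x _ hx =>
    exact hx.mono (mean_nonneg (sNum_nonneg _)) (C := 1)
      (mean_le_mul_mean fun n => by rw [one_mul]; exact sNum_neg_le x n)
  | left_absorb a x _ hx =>
    exact hx.mono (mean_nonneg (sNum_nonneg _)) (mean_le_mul_mean (sNum_mul_left_le a x))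
  | right_absorb b x _ hx =>
    exact hx.mono (mean_nonneg (sNum_nonneg _)) (mean_le_mul_mean (sNum_mul_right_le x b))

theorem arithMean_preArithMean_le (hH : ¬ FiniteDimensional ℂ H) (e : HilbertBasis ℕ ℂ H) :
    arithMean (preArithMean I) ≤ I := by
  refine idealOf_le hH e fun ξ hξ => ⟨hξ.1, ?_⟩
  obtain ⟨hξ0, η, ⟨-, X, hX, rfl⟩, C, hC⟩ := hξ
  exact (diagMem_mean_sNum hH e hX).mono hξ0.1 hC

theorem mem_amClosure (hH : ¬ FiniteDimensional ℂ H) (e : HilbertBasis ℕ ℂ H) {X : H →L[ℂ] H}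
    (hX : X ∈ I) (hX0 : sNum X ∈ c0star) : X ∈ amClosure I := by
  refine TwoSidedIdeal.subset_span ⟨hX0, (mem_charSet_iff hH e).2 ⟨mean_mem_c0star hX0, ?_⟩⟩
  exact diagMem_idealOf e (mean_mem_c0star hX0)
    ⟨mean_mem_c0star hX0, sNum X, ⟨hX0, X, hX, rfl⟩, 1, fun n => by rw [one_mul]⟩

/-- One inclusion is monotonicity applied to (_aI)_a ≤ I. The other need only be checked on
generators, whose s-numbers tend to 0 as `mem_amClosure` requires. -/
theorem isAmClosed_preArithMean (hH : ¬ FiniteDimensional ℂ H) (e : HilbertBasis ℕ ℂ H) :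
    IsAmClosed (preArithMean I) := by
  refine le_antisymm ?_ (preArithMean_mono (arithMean_preArithMean_le hH e))
  exact TwoSidedIdeal.span_le.2 fun X hX =>
    mem_amClosure hH e (TwoSidedIdeal.subset_span hX) hX.1

theorem IsAmClosed.le_preArithMean (hH : ¬ FiniteDimensional ℂ H) (e : HilbertBasis ℕ ℂ H)
    (hI : IsCountablyGenerated I) (hJI : J ≤ I) (hJ : IsAmClosed J) : J ≤ preArithMean I := by
  obtain ⟨σ, hσ, hσI⟩ := exists_countable_majorants hH e hI
  rw [hJ]
  refine TwoSidedIdeal.span_mono fun X hX => ?_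
  obtain ⟨hX0, hXm⟩ := hX
  refine ⟨hX0, (mem_charSet_iff hH e).2 ⟨hXm.1, ?_⟩⟩
  by_contra hcon
  -- Domination of the mean by a multiple of some σ_k would make it a diagonal of `I`, against
  -- `hcon`.
  obtain ⟨μ, hμ, hμX, hμσ⟩ := exists_mean_le_not_le hX0 σ fun k C => by
    by_contra! hle
    exact hcon ((hσ k).mono hXm.1.1 hle)
  have hμm : mean μ ∈ charSet (arithMean J) := (mem_charSet_iff hH e).2
    ⟨mean_mem_c0star hμ, ((mem_charSet_iff hH e).1 hXm).2.mono (mean_nonneg hμ.1) hμX⟩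
  -- Am-closedness is used here a second time: it carries μ from the closure of `J` back into `J`,
  -- hence into `I`.
  obtain ⟨D, hD, hDe⟩ : DiagMem (amClosure J) e μ := diagMem_idealOf e hμ ⟨hμ, hμm⟩
  rw [← hJ] at hD
  obtain ⟨k, hk⟩ := hσI D (hJI hD)
  obtain ⟨n, hn⟩ := hμσ k
  rw [sNum_diagonal e hμ.1 hμ.2.1 hDe] at hk
  exact absurd (hk n) (not_le.2 hn)

end

end AMIdeal

end

theorem theorem2p9 {H : Type*} [NormedAddCommGroup H] [InnerProductSpace ℂ H] [CompleteSpace H]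
    [TopologicalSpace.SeparableSpace H] (hH : ¬ FiniteDimensional ℂ H)
    (I : TwoSidedIdeal (H →L[ℂ] H)) (hI : AMIdeal.IsCountablyGenerated I) :
    IsGreatest {J : TwoSidedIdeal (H →L[ℂ] H) | J ≤ I ∧ AMIdeal.IsAmClosed J}
        (AMIdeal.preArithMean I) ∧
      AMIdeal.amLower I = (AMIdeal.preArithMean I : Set (H →L[ℂ] H)) := by
  obtain ⟨e⟩ := AMIdeal.exists_hilbertBasis_nat hH
  have hmem : AMIdeal.preArithMean I ∈
      {J : TwoSidedIdeal (H →L[ℂ] H) | J ≤ I ∧ AMIdeal.IsAmClosed J} :=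
    ⟨AMIdeal.preArithMean_le hH e, AMIdeal.isAmClosed_preArithMean hH e⟩
  have hmax : ∀ J : TwoSidedIdeal (H →L[ℂ] H), J ≤ I ∧ AMIdeal.IsAmClosed J →
      J ≤ AMIdeal.preArithMean I := fun J hJ => hJ.2.le_preArithMean hH e hI hJ.1
  exact ⟨⟨hmem, hmax⟩, Set.Subset.antisymm (Set.iUnion₂_subset hmax)
    (Set.subset_biUnion_of_mem (u := fun J : TwoSidedIdeal (H →L[ℂ] H) => (J : Set (H →L[ℂ] H)))
      hmem)⟩
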